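/- **Setting.** All codes are binary. For a binary matrix $H$ with $n$ columns, let $I_j$ be the support of its $j$-th row; the fundamental cone $\mathcal K(H)$ is the set of $x\in\mathbb R^n$ with $x_i\ge 0$ for all $i$ and $x_l\le\sum_{i\in I_j\setminus\{l\}}x_i$ for all rows $j$ and all $l\in I_j$. For a nonzero $x\in\mathcal K(H)$ the four pseudoweights are $w_{\rm BEC}(x)=|\mathrm{supp}(x)|$, $w_{\rm AWGNC}(x)=(\sum_i x_i)^2/\sum_i x_i^2$, $w_{\rm maxfrac}(x)=(\sum_i x_i)/\max_i x_i$, and $w_{\rm BSC}(x)=2\Phi^{-1}(\Phi(n)/2)$, where $\Phi(\xi)=\int_0^\xi\phi$ and $\phi$ equals on $(i-1,i]$ the $i$-th largest entry of $x$, for $1\le i\le n$. For a nonzero code $\mathcal C$ of length $n$ with minimum distance $d$ and for one of these pseudoweights $w$, the pseudoredundancy $\rho(\mathcal C)$ is the least number of rows of a parity-check matrix $H$ of $\mathcal C$ (linearly dependent rows are allowed) such that $\min\{w(x) : x\in\mathcal K(H)\setminus\{0\}\}=d$; it is $\infty$ if there is no such $H$. Let $k\ge1$, $t\ge0$, and let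 $p_1,\dots,p_{k+t}$ be distinct points of $PG(k-1,2)$ such that $p_1,\dots,p_k$ are independent (basis points). The representing-set $S_j$ of $p_{k+j}$, $1\le j\le t$, is the set of those basis points that have nonzero coefficient when $p_{k+j}$ is written as a linear combination of $p_1,\dots,p_k$. For $J\subseteq\{1,\dots,t\}$, the class of points $p_{k+j}$, $j\in J$, is *representing-independent* if the sets $S_j$, $j\in J$, are pairwise disjoint, and *representing-dependent* if for each $i\in J$ there is $j\in J$, $j\ne i$, with $S_i\cap S_j\neq\varnothing$. Let $U_1(J)$ be the set of basis points that lie in exactly one of the sets $S_j$, $j\in J$, and put $U_2(J)=(\bigcup_{j\in J}S_j)\setminus U_1(J)$, $U_3(J)=U_1(J)\cup\{p_{k+j}: j\in J\}$, $W_1(J)=\{j\in J: S_j\cap U_1(J)\ne\varnothing\}$, $W_2(J)=J\setminus W_1(J)$ and $I(J)=\bigcap_{j\in J}S_j$. **Theorem.** Let $m:PG(k-1,2)\to\mathbb N$ satisfy $m(p_i)\ge1$ for $1\le i\le k+t$ and $m(p)=0$ for all other points $p$. Suppose that $\{1,\dots,t\}$ can be divided into $\ell$ subsets such that 1. $S_i\cap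 S_j=\varnothing$ whenever $i$ and $j$ are in different subsets; 2. for each of these subsets $J$, the class of points $p_{k+j}$, $j\in J$, is representing-independent, or it is representing-dependent and satisfies one of the following conditions: (a) $W_2(J)=\varnothing$ and $\min\{m(p): p\in U_2(J)\}\ge\max\{m(p): p\in U_3(J)\}$; (b) $W_1(J)\ne\varnothing$, $W_2(J)\neq\varnothing$, $\min\{m(p): p\in U_2(J)\}\ge\max\{m(p): p\in U_3(J)\}$ and $\min\{m(p_{k+j}): j\in W_1(J)\}\le\min\{m(p_{k+j}): j\in W_2(J)\}$; (c) $|I(J)|\ge2$ and $\max\{m(p): p\in I(J)\}\le\min\{m(p): p\in((\bigcup_{j\in J}S_j)\setminus I(J))\cup\{p_{k+j}: j\in J\}\}$. Let $\mathcal C$ be the code determined by $m$, that is, the code generated by the rows of a $k\times n$ matrix $G$ whose columns are the points of $PG(k-1,2)$, each point $p$ occurring exactly $m(p)$ times (in any order). Then $\mathcal C$ is an $[n,k]$ code, and $\rho(\mathcal C)=n-k$ for all four pseudoweights. -/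

import Mathlib

namespace PseudoRedundancy

open Matrix

/-! ### Pseudocodewords and pseudoweights -/

/-- The support of row `j` of a binary matrix. -/
def rowSupport {s n : ℕ} (H : Matrix (Fin s) (Fin n) (ZMod 2)) (j : Fin s) : Finset (Fin n) :=
  Finset.univ.filter (fun i => H j i ≠ 0)

/-- The fundamental cone of a binary matrix. -/
def fundamentalCone {s n : ℕ} (H : Matrix (Fin s) (Fin n) (ZMod 2)) : Set (Fin n → ℝ) :=
  {x | (∀ j, ∀ l ∈ rowSupport H j, x l ≤ ∑ i ∈ (rowSupport H j).erase l, x i) ∧ ∀ i, 0 ≤ x i}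

/-- The entries of `x` in nonincreasing order. -/
noncomputable def sortedDesc {n : ℕ} (x : Fin n → ℝ) : Fin n → ℝ :=
  fun i => x (Tuple.sort (fun j => OrderDual.toDual (x j)) i)

/-- The step function whose value on `(i - 1, i]`, for `1 ≤ i ≤ n`, is the `i`-th largest entry
of `x`. (Indices of `Fin n` start at `0`; only the values on `(0, n]` are used.) -/
noncomputable def stepFun {n : ℕ} (x : Fin n → ℝ) (ξ : ℝ) : ℝ :=
  if h : ⌈ξ⌉₊ - 1 < n then sortedDesc x ⟨⌈ξ⌉₊ - 1, h⟩ else 0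

/-- The integral of the step function from `0` to `ξ`. -/
noncomputable def stepIntegral {n : ℕ} (x : Fin n → ℝ) (ξ : ℝ) : ℝ :=
  ∫ u in (0 : ℝ)..ξ, stepFun x u

/-- The four kinds of pseudoweights. -/
inductive Channel
  | BEC
  | AWGNC
  | BSC
  | maxfrac

/-- The pseudoweight of a (nonzero, nonnegative) vector. In the BSC case the inverse is taken on
`[0, n]`; for nonzero nonnegative `x` the integral takes half of its final value exactly once. -/
noncomputable def pseudoweight {n : ℕ} : Channel → (Fin n → ℝ) → ℝ
  | .BEC, x => ((Function.support x).ncard : ℝ)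
  | .AWGNC, x => (∑ i, x i) ^ 2 / ∑ i, x i ^ 2
  | .BSC, x => 2 * Function.invFunOn (stepIntegral x) (Set.Icc 0 (n : ℝ)) (stepIntegral x n / 2)
  | .maxfrac, x => (∑ i, x i) / ⨆ i, x i

/-- `w` is the minimum pseudoweight of the matrix `H`, that is, the minimum over the nonzero
vectors of the fundamental cone. -/
def IsMinPseudoweight {s n : ℕ} (ch : Channel) (H : Matrix (Fin s) (Fin n) (ZMod 2)) (w : ℝ) :
    Prop :=
  IsLeast (pseudoweight ch '' (fundamentalCone H \ {0})) w

/-! ### Codes and their pseudoredundancy -/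

/-- `H` is a parity-check matrix of the code `C`; its rows may be linearly dependent. -/
def IsParityCheck {s n : ℕ} (H : Matrix (Fin s) (Fin n) (ZMod 2))
    (C : Submodule (ZMod 2) (Fin n → ZMod 2)) : Prop :=
  ∀ c, c ∈ C ↔ H *ᵥ c = 0

/-- The minimum distance: the least Hamming weight of a nonzero codeword. -/
noncomputable def minDist {n : ℕ} (C : Submodule (ZMod 2) (Fin n → ZMod 2)) : ℕ :=
  sInf {d | ∃ c ∈ C, c ≠ 0 ∧ hammingNorm c = d}

/-- The pseudoredundancy: the least number of rows of a parity-check matrix whose minimum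
pseudoweight equals the minimum distance (`⊤` if there is none). -/
noncomputable def pseudoredundancy {n : ℕ} (ch : Channel)
    (C : Submodule (ZMod 2) (Fin n → ZMod 2)) : ℕ∞ :=
  sInf {r | ∃ (s : ℕ) (H : Matrix (Fin s) (Fin n) (ZMod 2)),
    IsParityCheck H C ∧ IsMinPseudoweight ch H (minDist C) ∧ r = s}

/-! ### Points and value assignments -/

/-- The projective space `PG(k - 1, 2)`. -/
abbrev PG (k : ℕ) : Type := Projectivization (ZMod 2) (Fin k → ZMod 2)

/-- `G` is a matrix given by the value assignment `m`: its columns are projective points, and each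
point `x` occurs exactly `m x` times among them. (This fixes `G` up to the order of columns.) -/
def Determines {k n : ℕ} (m : PG k → ℕ) (G : Matrix (Fin k) (Fin n) (ZMod 2)) : Prop :=
  ∃ h : ∀ j, Gᵀ j ≠ 0, ∀ x : PG k,
    {j : Fin n | Projectivization.mk (ZMod 2) (Gᵀ j) (h j) = x}.ncard = m x

/-- The code generated by the rows of `G`. -/
def codeOf {k n : ℕ} (G : Matrix (Fin k) (Fin n) (ZMod 2)) :
    Submodule (ZMod 2) (Fin n → ZMod 2) :=
  Submodule.span (ZMod 2) (Set.range G)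

/-- The representing-set of the point `x` with respect to the basis points `b`: the basis points
with nonzero coefficient when `x` is written as a linear combination of them. (Over the field with
two elements, `rep` is the only nonzero vector that represents a point.) -/
def reprSet {k : ℕ} (b : Fin k → PG k) (x : PG k) : Set (PG k) :=
  {y | ∃ c : Fin k → ZMod 2, x.rep = ∑ i, c i • (b i).rep ∧ ∃ i, c i ≠ 0 ∧ b i = y}

/-! ### Classes of points

In what follows `q j`, for `j` in an index set `J`, are the points of a class, and `S j` is
the representing-set of `q j`. -/

section Classes

variable {k t : ℕ} (S : Fin t → Set (PG k)) (q : Fin t → PG k) (m : PG k → ℕ) (J : Set (Fin t))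

/-- The representing-sets of the class are pairwise disjoint. -/
def RepresentingIndependent : Prop :=
  ∀ i ∈ J, ∀ j ∈ J, i ≠ j → S i ∩ S j = ∅

/-- Each representing-set of the class meets another one of the class. -/
def RepresentingDependent : Prop :=
  ∀ i ∈ J, ∃ j ∈ J, j ≠ i ∧ (S i ∩ S j).Nonempty

/-- The basis points in exactly one representing-set of the class. -/
def U₁ : Set (PG k) := {x | ∃! j, j ∈ J ∧ x ∈ S j}

/-- The basis points in at least two representing-sets of the class. -/
def U₂ : Set (PG k) := (⋃ j ∈ J, S j) \ U₁ S J

/-- `U₁` together with the points of the class. -/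
def U₃ : Set (PG k) := U₁ S J ∪ q '' J

/-- The members of the class whose representing-set meets `U₁`. -/
def W₁ : Set (Fin t) := {j | j ∈ J ∧ (S j ∩ U₁ S J).Nonempty}

/-- The members of the class whose representing-set does not meet `U₁`. -/
def W₂ : Set (Fin t) := {j | j ∈ J ∧ S j ∩ U₁ S J = ∅}

/-- The basis points in all representing-sets of the class. -/
def commonSet : Set (PG k) := ⋂ j ∈ J, S j

/-- Every representing-set meets `U₁`, and `min m(U₂) ≥ max m(U₃)`. -/
def CondOne : Prop :=
  (∀ j ∈ J, (S j ∩ U₁ S J).Nonempty) ∧ ∀ x ∈ U₂ S J, ∀ y ∈ U₃ S q J, m y ≤ m x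

/-- `W₁` and `W₂` are nonempty, `min m(U₂) ≥ max m(U₃)`, and the least value of `m` at the points
with index in `W₁` is at most the least value at those with index in `W₂`. -/
def CondTwo : Prop :=
  (W₁ S J).Nonempty ∧ (W₂ S J).Nonempty ∧
  (∀ x ∈ U₂ S J, ∀ y ∈ U₃ S q J, m y ≤ m x) ∧
  ∃ i ∈ W₁ S J, ∀ j ∈ W₂ S J, m (q i) ≤ m (q j)

/-- At least two basis points lie in all representing-sets, and the largest value at such points
is at most the least value at the other points that occur. -/
def CondThree : Prop :=
  2 ≤ (commonSet S J).ncard ∧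
  ∀ x ∈ commonSet S J, ∀ y ∈ ((⋃ j ∈ J, S j) \ commonSet S J) ∪ q '' J, m x ≤ m y

end Classes

end PseudoRedundancy

open PseudoRedundancy

namespace PseudoRedundancy

open Matrix

/-! ### Bounds for the pseudoweights -/

/-! Lower bound: by rank-nullity every parity-check matrix has at least `n - k` rows. So it suffices
to exhibit one matrix with `n - k` rows and minimum pseudoweight `d`. Regard the `k + t` points as
symbols, the symbol `s` being repeated `m (p s)` times. Choose one coordinate per symbol. Each of
the `n - k - t` other coordinates gets a row of weight two that ties it to the chosen one, and each
further point gets a row whose support `T j` consists of that point and its representing-set. A cone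
vector is then constant on repetitions and amounts to a vector `y` on symbols that satisfies the
cone inequalities of the `T j`. All four pseudoweights are at least `d` once `d * x l ≤ ∑ i, x i`
for all `l` (`le_pseudoweight`). This follows if any two symbols of a common check have
multiplicities adding up to at least `d` (`minDist_mul_le_sum`). Two symbols in exactly the same
checks ("twins") support a codeword, so their multiplicities add up to at least `d`
(`minDist_le_of_twins`). The class conditions provide light twins against which all other pairs of a
check are compared (`le_add_of_classes`). The value `d` is attained at the indicator of a minimum
weight codeword. -/

theorem sum_sortedDesc {n : ℕ} (x : Fin n → ℝ) : ∑ i, sortedDesc x i = ∑ i, x i :=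
  Equiv.sum_comp (Tuple.sort (fun j => OrderDual.toDual (x j))) x

theorem sortedDesc_antitone {n : ℕ} (x : Fin n → ℝ) : Antitone (sortedDesc x) := by
  intro i j hij
  exact Tuple.monotone_sort (fun j => OrderDual.toDual (x j)) hij

theorem stepFun_eq_of_mem_Ioc {n : ℕ} (x : Fin n → ℝ) (i : Fin n) {ξ : ℝ}
    (hξ : ξ ∈ Set.Ioc ((i : ℕ) : ℝ) (((i : ℕ) + 1 : ℕ) : ℝ)) : stepFun x ξ = sortedDesc x i := by
  have h : ⌈ξ⌉₊ = (i : ℕ) + 1 := by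
    rw [Nat.ceil_eq_iff (by omega)]
    simpa using hξ
  simp [stepFun, h]

theorem stepFun_nonneg {n : ℕ} {x : Fin n → ℝ} (hx : ∀ i, 0 ≤ x i) (ξ : ℝ) :
    0 ≤ stepFun x ξ := by
  unfold stepFun
  split_ifs
  · exact hx _
  · exact le_rfl

theorem stepFun_le {n : ℕ} {x : Fin n → ℝ} {M : ℝ} (hM : 0 ≤ M) (hx : ∀ i, x i ≤ M) (ξ : ℝ) :
    stepFun x ξ ≤ M := by
  unfold stepFun
  split_ifs
  · exact hx _
  · exact hM

theorem measurable_stepFun {n : ℕ} (x : Fin n → ℝ) : Measurable (stepFun x) := by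
  have h : stepFun x = (fun a : ℕ => if h : a - 1 < n then sortedDesc x ⟨a - 1, h⟩ else 0) ∘
      fun ξ : ℝ => ⌈ξ⌉₊ := rfl
  rw [h]
  exact (measurable_from_top).comp Nat.measurable_ceil

theorem intervalIntegrable_stepFun {n : ℕ} {x : Fin n → ℝ} (hx : ∀ i, 0 ≤ x i) (a b : ℝ) :
    IntervalIntegrable (stepFun x) MeasureTheory.volume a b := by
  refine (intervalIntegrable_const (c := ∑ i, x i)).mono_fun
    (measurable_stepFun x).aestronglyMeasurable (Filter.Eventually.of_forall fun ξ => ?_)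
  have hs : 0 ≤ ∑ i, x i := Finset.sum_nonneg fun i _ => hx i
  beta_reduce
  rw [Real.norm_of_nonneg (stepFun_nonneg hx ξ), Real.norm_of_nonneg hs]
  exact stepFun_le hs (fun i => Finset.single_le_sum (fun i _ => hx i) (Finset.mem_univ i)) ξ

theorem stepIntegral_zero {n : ℕ} (x : Fin n → ℝ) : stepIntegral x 0 = 0 := by
  simp [stepIntegral]

theorem stepIntegral_sub {n : ℕ} {x : Fin n → ℝ} (hx : ∀ i, 0 ≤ x i) (a b : ℝ) :
    stepIntegral x b - stepIntegral x a = ∫ u in a..b, stepFun x u :=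
  intervalIntegral.integral_interval_sub_left (intervalIntegrable_stepFun hx _ _)
    (intervalIntegrable_stepFun hx _ _)

theorem stepIntegral_natCast {n : ℕ} {x : Fin n → ℝ} (hx : ∀ i, 0 ≤ x i) :
    stepIntegral x n = ∑ i, x i := by
  have h := intervalIntegral.sum_integral_adjacent_intervals (f := stepFun x)
    (μ := MeasureTheory.volume) (a := fun i : ℕ => (i : ℝ)) (n := n)
    (fun i _ => intervalIntegrable_stepFun hx _ _)
  simp only [Nat.cast_zero] at h
  rw [stepIntegral, ← h, Finset.sum_range, ← sum_sortedDesc x]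
  refine Finset.sum_congr rfl fun i _ => ?_
  have hle : ((i : ℕ) : ℝ) ≤ (((i : ℕ) + 1 : ℕ) : ℝ) := by simp
  rw [intervalIntegral.integral_congr_ae
    (g := fun _ => sortedDesc x i) (Filter.Eventually.of_forall fun ξ hξ => ?_)]
  · simp
  · rw [Set.uIoc_of_le hle] at hξ
    exact stepFun_eq_of_mem_Ioc x i hξ

theorem stepIntegral_le_mul {n : ℕ} {x : Fin n → ℝ} {M ξ : ℝ} (h0 : ∀ i, 0 ≤ x i) (hM : 0 ≤ M)
    (hx : ∀ i, x i ≤ M) (hξ : 0 ≤ ξ) : stepIntegral x ξ ≤ M * ξ := by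
  have h := intervalIntegral.integral_mono_on hξ (intervalIntegrable_stepFun h0 0 ξ)
    (intervalIntegrable_const (c := M)) (fun u _ => stepFun_le hM hx u)
  simpa [stepIntegral, mul_comm] using h

theorem stepIntegral_mono {n : ℕ} {x : Fin n → ℝ} (hx : ∀ i, 0 ≤ x i) :
    Monotone (stepIntegral x) := by
  intro a b hab
  rw [← sub_nonneg, stepIntegral_sub hx]
  exact intervalIntegral.integral_nonneg hab fun u _ => stepFun_nonneg hx u

theorem exists_stepIntegral_eq_half {n : ℕ} {x : Fin n → ℝ} (hx : ∀ i, 0 ≤ x i) :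
    ∃ ξ ∈ Set.Icc (0 : ℝ) n, stepIntegral x ξ = stepIntegral x n / 2 := by
  have hc : ContinuousOn (stepIntegral x) (Set.Icc 0 (n : ℝ)) :=
    (intervalIntegral.continuous_primitive (intervalIntegrable_stepFun hx) 0).continuousOn
  have hn : (0 : ℝ) ≤ stepIntegral x n := by
    rw [stepIntegral_natCast hx]
    exact Finset.sum_nonneg fun i _ => hx i
  refine intermediate_value_Icc n.cast_nonneg hc ⟨?_, ?_⟩
  · rw [stepIntegral_zero]
    linarith
  · linarith

/-- The hypothesis bounds the max-fractional weight, which is the smallest of the four: with `M =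
max x`, one has `∑ x ≤ |supp x| * M` and `∑ x² ≤ M * ∑ x`, and collecting half of the total needs
length at least `∑ x / (2 * M)`. -/
theorem le_pseudoweight {n : ℕ} {x : Fin n → ℝ} {d : ℝ} (h0 : ∀ i, 0 ≤ x i) (hx : x ≠ 0)
    (h : ∀ l, d * x l ≤ ∑ i, x i) (ch : Channel) : d ≤ pseudoweight ch x := by
  obtain ⟨i₀, hi₀⟩ := Function.ne_iff.1 hx
  have : Nonempty (Fin n) := ⟨i₀⟩
  obtain ⟨l, hl⟩ := Finite.exists_max x
  have hpos : 0 < x l := lt_of_lt_of_le (lt_of_le_of_ne (h0 i₀) (Ne.symm hi₀)) (hl i₀)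
  have hspos : 0 < ∑ i, x i := Finset.sum_pos' (fun i _ => h0 i) ⟨l, Finset.mem_univ _, hpos⟩
  cases ch with
  | BEC =>
    have h1 : ∑ i, x i ≤ (Function.support x).ncard * x l := by
      classical
      have h2 : ∑ i, x i = ∑ i ∈ Finset.univ.filter (fun i => x i ≠ 0), x i :=
        (Finset.sum_filter_ne_zero _).symm
      have h3 : (Function.support x).ncard = (Finset.univ.filter (fun i => x i ≠ 0)).card := by
        rw [← Set.ncard_coe_finset]
        congr 1
        ext i
        simp
      rw [h2, h3, ← nsmul_eq_mul]
      exact Finset.sum_le_card_nsmul _ _ _ fun i _ => hl i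
    exact le_of_mul_le_mul_right ((h l).trans h1) hpos
  | AWGNC =>
    have h1 : ∑ i, x i ^ 2 ≤ x l * ∑ i, x i := by
      rw [Finset.mul_sum]
      refine Finset.sum_le_sum fun i _ => ?_
      rw [sq]
      exact mul_le_mul_of_nonneg_right (hl i) (h0 i)
    have h2 : 0 < ∑ i, x i ^ 2 :=
      Finset.sum_pos' (fun i _ => sq_nonneg _) ⟨l, Finset.mem_univ _, by positivity⟩
    change d ≤ (∑ i, x i) ^ 2 / ∑ i, x i ^ 2
    rw [le_div_iff₀ h2]
    rcases le_total d 0 with hd | hd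
    · exact (mul_nonpos_of_nonpos_of_nonneg hd h2.le).trans (sq_nonneg _)
    · calc d * ∑ i, x i ^ 2 ≤ d * (x l * ∑ i, x i) := mul_le_mul_of_nonneg_left h1 hd
        _ = d * x l * ∑ i, x i := by ring
        _ ≤ (∑ i, x i) * ∑ i, x i := mul_le_mul_of_nonneg_right (h l) hspos.le
        _ = _ := by ring
  | BSC =>
    -- Half of the total is attained on `[0, n]`, so `invFunOn` is a true preimage and not a default
    -- value.
    have he := exists_stepIntegral_eq_half h0
    have hm := Function.invFunOn_mem he
    have hv := Function.invFunOn_eq he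
    change d ≤ 2 * Function.invFunOn (stepIntegral x) (Set.Icc 0 (n : ℝ)) (stepIntegral x n / 2)
    have h1 := stepIntegral_le_mul h0 hpos.le hl hm.1
    rw [hv, stepIntegral_natCast h0] at h1
    rw [stepIntegral_natCast h0]
    refine le_of_mul_le_mul_right ?_ hpos
    linarith [h l]
  | maxfrac =>
    change d ≤ (∑ i, x i) / ⨆ i, x i
    have h1 : ⨆ i, x i = x l :=
      le_antisymm (ciSup_le hl) (le_ciSup (Set.finite_range x).bddAbove l)
    rw [h1, le_div_iff₀ hpos]
    exact h l

theorem stepIntegral_eq_self {n d : ℕ} {x : Fin n → ℝ} (hx : ∀ i, x i = 0 ∨ x i = 1)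
    (hd : ∑ i, x i = d) {ξ : ℝ} (h0 : 0 ≤ ξ) (hξ : ξ ≤ d) : stepIntegral x ξ = ξ := by
  have hdn : d ≤ n := by
    have h1 : ∑ i, x i ≤ ∑ _i : Fin n, (1 : ℝ) :=
      Finset.sum_le_sum fun i _ => by rcases hx i with h | h <;> simp [h]
    rw [hd] at h1
    exact_mod_cast (by simpa using h1 : (d : ℝ) ≤ n)
  have hone : ∀ i : Fin n, (i : ℕ) < d → sortedDesc x i = 1 := by
    intro i hi
    -- If the entry at the zero-based index `i` vanished, so would all later ones, and the total
    -- would be at most `i < d`.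
    refine (hx _).resolve_left fun h => ?_
    have h1 : ∑ a, sortedDesc x a ≤ ∑ a, if a < i then (1 : ℝ) else 0 := by
      refine Finset.sum_le_sum fun a _ => ?_
      split_ifs with ha
      · rcases hx (Tuple.sort (fun j => OrderDual.toDual (x j)) a) with h' | h' <;>
          simp [sortedDesc, h']
      · exact (sortedDesc_antitone x (not_lt.1 ha)).trans h.le
    rw [sum_sortedDesc, hd, Finset.sum_boole] at h1
    have h2 : (Finset.univ.filter (fun a => a < i)).card = (i : ℕ) := by
      rw [Finset.filter_gt_eq_Iio, Fin.card_Iio]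
    rw [h2] at h1
    have : d ≤ (i : ℕ) := by exact_mod_cast h1
    omega
  rw [stepIntegral, intervalIntegral.integral_congr_ae (g := fun _ => (1 : ℝ))
    (Filter.Eventually.of_forall fun u hu => ?_)]
  · simp
  · rw [Set.uIoc_of_le h0] at hu
    have hc : 0 < ⌈u⌉₊ := Nat.ceil_pos.2 hu.1
    have hc' : ⌈u⌉₊ ≤ d := Nat.ceil_le.2 (hu.2.trans hξ)
    have hlt : ⌈u⌉₊ - 1 < n := by omega
    simp only [stepFun, hlt, dif_pos]
    exact hone _ (by simp only; omega)

theorem pseudoweight_of_zero_one {n d : ℕ} {x : Fin n → ℝ} (hx : ∀ i, x i = 0 ∨ x i = 1)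
    (hd : ∑ i, x i = d) (hne : x ≠ 0) (ch : Channel) : pseudoweight ch x = d := by
  have h0 : ∀ i, 0 ≤ x i := fun i => by rcases hx i with h | h <;> simp [h]
  have hle : ∀ i, x i ≤ 1 := fun i => by rcases hx i with h | h <;> simp [h]
  obtain ⟨l, hl⟩ := Function.ne_iff.1 hne
  have hl1 : x l = 1 := (hx l).resolve_left hl
  have hspos : 0 < ∑ i, x i :=
    Finset.sum_pos' (fun i _ => h0 i) ⟨l, Finset.mem_univ _, by simp [hl1]⟩
  have hdpos : (0 : ℝ) < d := hd ▸ hspos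
  refine le_antisymm ?_ (le_pseudoweight h0 hne (fun i => ?_) ch)
  · cases ch with
    | BEC =>
      change ((Function.support x).ncard : ℝ) ≤ d
      have h3 : (Function.support x).ncard = (Finset.univ.filter (fun i => x i ≠ 0)).card := by
        rw [← Set.ncard_coe_finset]
        congr 1
        ext i
        simp
      rw [h3, ← hd, ← Finset.sum_boole]
      exact Finset.sum_le_sum fun i _ => by rcases hx i with h | h <;> simp [h]
    | AWGNC =>
      have h1 : ∑ i, x i ^ 2 = ∑ i, x i :=
        Finset.sum_congr rfl fun i _ => by rcases hx i with h | h <;> simp [h]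
      change (∑ i, x i) ^ 2 / ∑ i, x i ^ 2 ≤ d
      rw [h1, hd, sq, mul_div_cancel_right₀ _ hdpos.ne']
    | BSC =>
      have he := exists_stepIntegral_eq_half h0
      have hm := Function.invFunOn_mem he
      have hv := Function.invFunOn_eq he
      change 2 * Function.invFunOn (stepIntegral x) (Set.Icc 0 (n : ℝ)) (stepIntegral x n / 2) ≤ d
      set ξ := Function.invFunOn (stepIntegral x) (Set.Icc 0 (n : ℝ)) (stepIntegral x n / 2)
      rw [stepIntegral_natCast h0, hd] at hv
      rcases le_total ξ d with h | h
      · rw [stepIntegral_eq_self hx hd hm.1 h] at hv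
        linarith
      -- A preimage beyond `d` would give `d ≤ d / 2` by monotonicity, although `d > 0`.
      · have h1 := stepIntegral_mono h0 h
        rw [stepIntegral_eq_self hx hd hdpos.le le_rfl, hv] at h1
        linarith
    | maxfrac =>
      have : Nonempty (Fin n) := ⟨l⟩
      have h1 : ⨆ i, x i = 1 := le_antisymm (ciSup_le hle)
        (hl1 ▸ le_ciSup (Set.finite_range x).bddAbove l)
      change (∑ i, x i) / ⨆ i, x i ≤ d
      rw [h1, div_one, hd]
  · rw [hd]
    exact mul_le_of_le_one_right hdpos.le (hle i)

/-! ### Codes and parity-check matrices -/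

theorem mem_codeOf {k n : ℕ} {G : Matrix (Fin k) (Fin n) (ZMod 2)} {c : Fin n → ZMod 2} :
    c ∈ codeOf G ↔ ∃ u : Fin k → ZMod 2, ∀ i, c i = u ⬝ᵥ Gᵀ i := by
  have h : codeOf G = LinearMap.range G.vecMulLinear := (range_vecMulLinear G).symm
  rw [h, LinearMap.mem_range]
  exact exists_congr fun u => ⟨fun h i => h ▸ rfl, fun h => funext fun i => (h i).symm⟩

theorem finrank_codeOf {k n : ℕ} {G : Matrix (Fin k) (Fin n) (ZMod 2)}
    (hG : ⊤ ≤ Submodule.span (ZMod 2) (Set.range Gᵀ)) :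
    Module.finrank (ZMod 2) (codeOf G) = k := by
  have hspan : Submodule.span (ZMod 2) (Set.range Gᵀ) = ⊤ := top_le_iff.1 hG
  have h1 : G.rank = k := by
    have h2 := Matrix.rank_eq_finrank_span_cols G
    change G.rank = Module.finrank (ZMod 2) (Submodule.span (ZMod 2) (Set.range Gᵀ)) at h2
    rw [h2, hspan, finrank_top, Module.finrank_fin_fun]
  rw [Matrix.rank_eq_finrank_span_row] at h1
  exact h1

theorem minDist_le {n : ℕ} {C : Submodule (ZMod 2) (Fin n → ZMod 2)} {c : Fin n → ZMod 2}
    (hc : c ∈ C) (h0 : c ≠ 0) : minDist C ≤ hammingNorm c :=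
  Nat.sInf_le ⟨c, hc, h0, rfl⟩

theorem exists_hammingNorm_eq_minDist {n : ℕ} {C : Submodule (ZMod 2) (Fin n → ZMod 2)}
    (hC : C ≠ ⊥) : ∃ c ∈ C, c ≠ 0 ∧ hammingNorm c = minDist C := by
  obtain ⟨c, hc, h0⟩ := Submodule.exists_mem_ne_zero_of_ne_bot hC
  exact Nat.sInf_mem (s := {d | ∃ c ∈ C, c ≠ 0 ∧ hammingNorm c = d}) ⟨_, c, hc, h0, rfl⟩

theorem IsParityCheck.sub_finrank_le {s n : ℕ} {H : Matrix (Fin s) (Fin n) (ZMod 2)}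
    {C : Submodule (ZMod 2) (Fin n → ZMod 2)} (h : IsParityCheck H C) :
    n - Module.finrank (ZMod 2) C ≤ s := by
  have hC : C = LinearMap.ker H.mulVecLin := by
    ext c
    rw [h c, LinearMap.mem_ker, Matrix.mulVecLin_apply]
  have h1 := LinearMap.finrank_range_add_finrank_ker H.mulVecLin
  have h2 := Submodule.finrank_le (LinearMap.range H.mulVecLin)
  rw [Module.finrank_fin_fun] at h1 h2
  rw [hC]
  omega

/-- By parity, a one of the codeword in the support of a row is accompanied there by another one. -/
theorem indicator_mem_fundamentalCone {s n : ℕ} {H : Matrix (Fin s) (Fin n) (ZMod 2)}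
    {c : Fin n → ZMod 2} (h : H *ᵥ c = 0) :
    (fun i => if c i = 0 then (0 : ℝ) else 1) ∈ fundamentalCone H := by
  have h0 : ∀ i, (0 : ℝ) ≤ if c i = 0 then (0 : ℝ) else 1 := fun i => by split_ifs <;> norm_num
  refine ⟨fun j l hl => ?_, h0⟩
  by_cases hcl : c l = 0
  · simp only [hcl, if_true]
    exact Finset.sum_nonneg fun i _ => h0 i
  · have hone : ∀ a : ZMod 2, a ≠ 0 → a = 1 := by decide
    have hsum : ∑ i ∈ rowSupport H j, c i = 0 := by
      have h1 : ∑ i, H j i * c i = 0 := congrFun h j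
      rw [rowSupport, Finset.sum_filter]
      refine Eq.trans ?_ h1
      refine Finset.sum_congr rfl fun i _ => ?_
      split_ifs with hi
      · rw [hone _ hi, one_mul]
      · rw [not_not.1 hi, zero_mul]
    rw [← Finset.add_sum_erase _ _ hl] at hsum
    obtain ⟨i, hi, hci⟩ : ∃ i ∈ (rowSupport H j).erase l, c i ≠ 0 := by
      by_contra! hall
      rw [Finset.sum_eq_zero hall, add_zero] at hsum
      exact hcl hsum
    calc (if c l = 0 then (0 : ℝ) else 1) = if c i = 0 then (0 : ℝ) else 1 := by simp [hcl, hci]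
      _ ≤ _ := Finset.single_le_sum (f := fun i => if c i = 0 then (0 : ℝ) else 1)
        (fun i _ => h0 i) hi

theorem isMinPseudoweight_minDist {s n : ℕ} {H : Matrix (Fin s) (Fin n) (ZMod 2)}
    {C : Submodule (ZMod 2) (Fin n → ZMod 2)} (hH : IsParityCheck H C) (hC : C ≠ ⊥)
    (h : ∀ x ∈ fundamentalCone H, ∀ l, (minDist C : ℝ) * x l ≤ ∑ i, x i) (ch : Channel) :
    IsMinPseudoweight ch H (minDist C) := by
  constructor
  · obtain ⟨c, hc, h0, hd⟩ := exists_hammingNorm_eq_minDist hC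
    have hne : (fun i => if c i = 0 then (0 : ℝ) else 1) ≠ 0 := by
      obtain ⟨i, hi⟩ := Function.ne_iff.1 h0
      exact Function.ne_iff.2 ⟨i, by simpa using hi⟩
    refine ⟨_, ⟨indicator_mem_fundamentalCone ((hH c).1 hc), hne⟩,
      pseudoweight_of_zero_one (fun i => by split_ifs <;> simp) ?_ hne ch⟩
    rw [← hd, hammingNorm, ← Finset.sum_boole]
    exact Finset.sum_congr rfl fun i _ => by by_cases hi : c i = 0 <;> simp [hi]
  · rintro _ ⟨x, ⟨hx, hx0⟩, rfl⟩
    exact le_pseudoweight hx.2 hx0 (h x hx) ch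

theorem pseudoredundancy_eq {r n : ℕ} {H : Matrix (Fin r) (Fin n) (ZMod 2)}
    {C : Submodule (ZMod 2) (Fin n → ZMod 2)} (hH : IsParityCheck H C) (hC : C ≠ ⊥)
    (hr : r = n - Module.finrank (ZMod 2) C)
    (h : ∀ x ∈ fundamentalCone H, ∀ l, (minDist C : ℝ) * x l ≤ ∑ i, x i) (ch : Channel) :
    pseudoredundancy ch C = (r : ℕ∞) := by
  refine le_antisymm (sInf_le ⟨r, H, hH, isMinPseudoweight_minDist hH hC h ch, rfl⟩) ?_
  refine le_sInf ?_
  rintro _ ⟨s, H', hH', -, rfl⟩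
  rw [hr]
  exact_mod_cast hH'.sub_finrank_le

/-- The binary matrix whose rows have the given supports. -/
def matrixOfSupports {N n : ℕ} (F : Fin N → Finset (Fin n)) : Matrix (Fin N) (Fin n) (ZMod 2) :=
  fun a i => if i ∈ F a then 1 else 0

theorem rowSupport_matrixOfSupports {N n : ℕ} (F : Fin N → Finset (Fin n)) (a : Fin N) :
    rowSupport (matrixOfSupports F) a = F a := by
  ext i
  simp [rowSupport, matrixOfSupports]

theorem matrixOfSupports_mulVec {N n : ℕ} (F : Fin N → Finset (Fin n)) (c : Fin n → ZMod 2)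
    (a : Fin N) : (matrixOfSupports F *ᵥ c) a = ∑ i ∈ F a, c i := by
  simp [Matrix.mulVec, dotProduct, matrixOfSupports]

/-! ### Codes with repeated coordinates

The coordinates of the code take their values from `k + t` symbols, which are subject to `t`
checks with supports `T j`. -/

section Repeated

variable {k t n : ℕ}

/-- The code whose words `c` are given by `c i = y (col i)`, where `y` satisfies the checks with
supports `T j`. -/
def IsRepeatedCode (col : Fin n → Fin k ⊕ Fin t) (T : Fin t → Finset (Fin k ⊕ Fin t))
    (C : Submodule (ZMod 2) (Fin n → ZMod 2)) : Prop :=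
  ∀ c, c ∈ C ↔ ∃ y : Fin k ⊕ Fin t → ZMod 2, (∀ j, ∑ s ∈ T j, y s = 0) ∧ ∀ i, c i = y (col i)

/-- The number of coordinates that repeat the symbol `s`. -/
def symbolMult (col : Fin n → Fin k ⊕ Fin t) (s : Fin k ⊕ Fin t) : ℕ :=
  (Finset.univ.filter (fun i => col i = s)).card

/-- `r` picks one coordinate per symbol. The rows are `{i, r (col i)}` for `i` outside the range of
`r`, and the images of the `T j`; surjectivity of `col` makes their number `(n - (k + t)) + t`. -/
theorem exists_parityCheck {col : Fin n → Fin k ⊕ Fin t} (hcol : Function.Surjective col)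
    {T : Fin t → Finset (Fin k ⊕ Fin t)} {C : Submodule (ZMod 2) (Fin n → ZMod 2)}
    (hC : IsRepeatedCode col T C) :
    ∃ H : Matrix (Fin (n - k)) (Fin n) (ZMod 2), IsParityCheck H C ∧
      ∀ x ∈ fundamentalCone H, ∃ y : Fin k ⊕ Fin t → ℝ, (∀ i, x i = y (col i)) ∧
        (∀ s, 0 ≤ y s) ∧ ∀ j, ∀ l ∈ T j, y l ≤ ∑ s ∈ (T j).erase l, y s := by
  classical
  obtain ⟨r, hr⟩ := hcol.hasRightInverse
  have hrinj : Function.Injective r := hr.injective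
  have hcard : Fintype.card ({i : Fin n // i ∉ Set.range r} ⊕ Fin t) = n - k := by
    have h1 := Fintype.card_subtype_compl (fun i => i ∈ Set.range r)
    have h2 : Fintype.card {i // i ∈ Set.range r} = k + t := by
      rw [← Fintype.card_congr (Equiv.ofInjective r hrinj)]
      simp
    have h3 := Fintype.card_le_of_injective r hrinj
    simp only [Fintype.card_sum, Fintype.card_fin] at h1 h2 h3 ⊢
    omega
  let e := (Fintype.equivFinOfCardEq hcard).symm
  let F : {i : Fin n // i ∉ Set.range r} ⊕ Fin t → Finset (Fin n) :=
    Sum.elim (fun i => {i.1, r (col i.1)}) (fun j => (T j).image r)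
  have hne : ∀ i : {i : Fin n // i ∉ Set.range r}, i.1 ≠ r (col i.1) :=
    fun i h => i.2 ⟨_, h.symm⟩
  have hsum : ∀ j, ∀ f : Fin n → ZMod 2, ∑ i ∈ (T j).image r, f i = ∑ s ∈ T j, f (r s) :=
    fun j f => Finset.sum_image fun a _ b _ h => hrinj h
  have htwo : ∀ a b : ZMod 2, a + b = 0 ↔ a = b := by decide
  refine ⟨matrixOfSupports fun a => F (e a), fun c => ?_, fun x hx => ?_⟩
  · have hH : matrixOfSupports (fun a => F (e a)) *ᵥ c = 0 ↔ ∀ ρ, ∑ i ∈ F ρ, c i = 0 := by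
      rw [funext_iff, ← e.forall_congr_right]
      simp only [matrixOfSupports_mulVec, Pi.zero_apply]
    rw [hH, hC c, Sum.forall]
    constructor
    · rintro ⟨y, hy, hc⟩
      refine ⟨fun i => ?_, fun j => ?_⟩
      · change ∑ i ∈ {i.1, r (col i.1)}, c i = 0
        rw [Finset.sum_pair (hne i), hc, hc, hr]
        exact (htwo _ _).2 rfl
      · change ∑ i ∈ (T j).image r, c i = 0
        rw [hsum]
        simpa only [hc, hr _] using hy j
    · rintro ⟨h1, h2⟩
      refine ⟨fun s => c (r s), fun j => ?_, fun i => ?_⟩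
      · rw [← hsum]
        exact h2 j
      · by_cases hi : i ∈ Set.range r
        · obtain ⟨s, rfl⟩ := hi
          rw [hr]
        · have h := h1 ⟨i, hi⟩
          change ∑ i ∈ {i, r (col i)}, c i = 0 at h
          rw [Finset.sum_pair (hne ⟨i, hi⟩)] at h
          exact (htwo _ _).1 h
  · have hcone : ∀ ρ, ∀ l ∈ F ρ, x l ≤ ∑ i ∈ (F ρ).erase l, x i := by
      intro ρ l hl
      have h := hx.1 (e.symm ρ) l
      rw [rowSupport_matrixOfSupports, e.apply_symm_apply] at h
      exact h hl
    refine ⟨fun s => x (r s), fun i => ?_, fun s => hx.2 _, fun j l hl => ?_⟩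
    · by_cases hi : i ∈ Set.range r
      · obtain ⟨s, rfl⟩ := hi
        rw [hr]
      · have hi' := hne ⟨i, hi⟩
        -- The two cone inequalities of a row of weight two force equality of its entries.
        have h1 := hcone (Sum.inl ⟨i, hi⟩) i (by simp [F])
        have h2 := hcone (Sum.inl ⟨i, hi⟩) (r (col i)) (by simp [F])
        simp only [F, Sum.elim_inl] at h1 h2
        rw [Finset.erase_insert (by simpa using hi'), Finset.sum_singleton] at h1
        rw [Finset.pair_comm, Finset.erase_insert (by simpa using hi'.symm),
          Finset.sum_singleton] at h2
        exact le_antisymm h1 h2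
    · have h := hcone (Sum.inr j) (r l) (Finset.mem_image_of_mem r hl)
      simp only [F, Sum.elim_inr] at h
      rwa [← Finset.image_erase hrinj, Finset.sum_image fun a _ b _ h => hrinj h] at h

theorem minDist_le_sum_symbolMult {col : Fin n → Fin k ⊕ Fin t}
    (hcol : Function.Surjective col) {T : Fin t → Finset (Fin k ⊕ Fin t)}
    {C : Submodule (ZMod 2) (Fin n → ZMod 2)} (hC : IsRepeatedCode col T C)
    {A : Finset (Fin k ⊕ Fin t)} (hA : A.Nonempty)
    (hT : ∀ j, ∑ s ∈ T j, (if s ∈ A then (1 : ZMod 2) else 0) = 0) :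
    minDist C ≤ ∑ s ∈ A, symbolMult col s := by
  obtain ⟨a, ha⟩ := hA
  obtain ⟨i, rfl⟩ := hcol a
  refine (minDist_le (c := fun i => if col i ∈ A then (1 : ZMod 2) else 0)
    ((hC _).2 ⟨_, hT, fun i => rfl⟩) (Function.ne_iff.2 ⟨i, by simp [ha]⟩)).trans ?_
  refine le_of_eq ?_
  rw [hammingNorm, Finset.card_eq_sum_card_fiberwise (f := col) (t := A)
    (fun i hi => by simpa using hi)]
  refine Finset.sum_congr rfl fun s hs => ?_
  rw [symbolMult, Finset.filter_filter]
  congr 1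
  ext i
  simp only [Finset.mem_filter, Finset.mem_univ, true_and]
  constructor
  · exact fun h => h.2
  · rintro rfl
    simp [hs]

/-- Every check contains both symbols or neither, so the indicator of the pair has even overlap with
each check and gives a codeword. -/
theorem minDist_le_of_twins {col : Fin n → Fin k ⊕ Fin t}
    (hcol : Function.Surjective col) {T : Fin t → Finset (Fin k ⊕ Fin t)}
    {C : Submodule (ZMod 2) (Fin n → ZMod 2)} (hC : IsRepeatedCode col T C)
    {a b : Fin k ⊕ Fin t} (hab : a ≠ b) (h : ∀ j, a ∈ T j ↔ b ∈ T j) :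
    minDist C ≤ symbolMult col a + symbolMult col b := by
  rw [← Finset.sum_pair hab]
  refine minDist_le_sum_symbolMult hcol hC ⟨a, by simp⟩ fun j => ?_
  rw [Finset.sum_ite_mem, Finset.sum_const, nsmul_one]
  by_cases ha : a ∈ T j
  · rw [Finset.inter_eq_right.2 (by simp [Finset.insert_subset_iff, ha, (h j).1 ha]),
      Finset.card_pair hab]
    rfl
  · rw [Finset.disjoint_iff_inter_eq_empty.1]
    · simp
    · simp [ha, (h j).not.1 ha]

/-- Write `μ` for the multiplicity. If `l` lies in a check, its cone inequality is multiplied by `d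
- μ l`, which `hpair` bounds by `μ s` for every other symbol `s` of the check. -/
theorem minDist_mul_le_sum {col : Fin n → Fin k ⊕ Fin t}
    (hcol : Function.Surjective col) {T : Fin t → Finset (Fin k ⊕ Fin t)}
    {C : Submodule (ZMod 2) (Fin n → ZMod 2)} (hC : IsRepeatedCode col T C)
    (hpair : ∀ j, ∀ a ∈ T j, ∀ b ∈ T j, a ≠ b →
      minDist C ≤ symbolMult col a + symbolMult col b)
    {y : Fin k ⊕ Fin t → ℝ} (h0 : ∀ s, 0 ≤ y s)
    (hy : ∀ j, ∀ l ∈ T j, y l ≤ ∑ s ∈ (T j).erase l, y s) (l : Fin k ⊕ Fin t) :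
    (minDist C : ℝ) * y l ≤ ∑ i, y (col i) := by
  have hsum : ∑ i, y (col i) = ∑ s, (symbolMult col s : ℝ) * y s := by
    rw [← Finset.sum_fiberwise' Finset.univ col y]
    exact Finset.sum_congr rfl fun s _ => by rw [Finset.sum_const, nsmul_eq_mul]; rfl
  have hnn : ∀ s, 0 ≤ (symbolMult col s : ℝ) * y s :=
    fun s => mul_nonneg (Nat.cast_nonneg _) (h0 s)
  have hl : (symbolMult col l : ℝ) * y l ≤ ∑ s, (symbolMult col s : ℝ) * y s :=
    Finset.single_le_sum (f := fun s => (symbolMult col s : ℝ) * y s)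
      (fun s _ => hnn s) (Finset.mem_univ l)
  rw [hsum]
  rcases le_total (minDist C) (symbolMult col l) with hd | hd
  · exact (mul_le_mul_of_nonneg_right (by exact_mod_cast hd) (h0 l)).trans hl
  by_cases hex : ∃ j, l ∈ T j
  · obtain ⟨j, hj⟩ := hex
    have hd' : (0 : ℝ) ≤ minDist C - symbolMult col l := sub_nonneg.2 (by exact_mod_cast hd)
    calc (minDist C : ℝ) * y l
        = symbolMult col l * y l + (minDist C - symbolMult col l) * y l := by ring
      _ ≤ symbolMult col l * y l +
          (minDist C - symbolMult col l) * ∑ s ∈ (T j).erase l, y s := by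
        gcongr
        exact hy j l hj
      _ ≤ symbolMult col l * y l + ∑ s ∈ (T j).erase l, (symbolMult col s : ℝ) * y s := by
        rw [Finset.mul_sum]
        gcongr with s hs
        · exact h0 s
        · rw [sub_le_iff_le_add']
          exact_mod_cast hpair j l hj s (Finset.mem_of_mem_erase hs)
            (Finset.ne_of_mem_erase hs).symm
      _ = ∑ s ∈ T j, (symbolMult col s : ℝ) * y s :=
        Finset.add_sum_erase _ (fun s => (symbolMult col s : ℝ) * y s) hj
      _ ≤ _ := Finset.sum_le_sum_of_subset_of_nonneg (Finset.subset_univ _) fun s _ _ => hnn s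
  -- A symbol in no check is unconstrained and supports a codeword alone.
  · have h := minDist_le_sum_symbolMult hcol hC (A := {l}) ⟨l, by simp⟩ fun j =>
      Finset.sum_eq_zero fun s hs => if_neg fun hsl =>
        hex ⟨j, by rwa [Finset.mem_singleton.1 hsl] at hs⟩
    rw [Finset.sum_singleton] at h
    exact (mul_le_mul_of_nonneg_right (by exact_mod_cast h) (h0 l)).trans hl

theorem pseudoredundancy_of_isRepeatedCode {col : Fin n → Fin k ⊕ Fin t}
    (hcol : Function.Surjective col) {T : Fin t → Finset (Fin k ⊕ Fin t)}
    {C : Submodule (ZMod 2) (Fin n → ZMod 2)} (hC : IsRepeatedCode col T C) (hk : 1 ≤ k)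
    (hrank : Module.finrank (ZMod 2) C = k)
    (hpair : ∀ j, ∀ a ∈ T j, ∀ b ∈ T j, a ≠ b →
      minDist C ≤ symbolMult col a + symbolMult col b) (ch : Channel) :
    pseudoredundancy ch C = ((n - k : ℕ) : ℕ∞) := by
  obtain ⟨H, hH, hcone⟩ := exists_parityCheck hcol hC
  refine pseudoredundancy_eq hH ?_ (by rw [hrank]) (fun x hx l => ?_) ch
  · rintro rfl
    rw [finrank_bot] at hrank
    omega
  · obtain ⟨y, hxy, h0, hy⟩ := hcone x hx
    simp only [hxy]
    exact minDist_mul_le_sum hcol hC hpair h0 hy _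

end Repeated

/-! ### Pairs of points in a check -/

/-- Members of `T` outside `D` may be replaced by lighter members of `D`; two of these are needed so
that the replacement can differ from the other element of the pair. -/
theorem le_add_of_light {ι : Type*} {f : ι → ℕ} {d : ℕ} {D T : Set ι}
    (hD : ∀ a ∈ D, ∀ b ∈ D, a ≠ b → d ≤ f a + f b) {u v : ι} (hu : u ∈ D) (hv : v ∈ D)
    (huv : u ≠ v) (hdom : ∀ a ∈ T, a ∉ D → ∀ b ∈ D, f b ≤ f a) {a b : ι} (ha : a ∈ T)
    (hb : b ∈ T) (hab : a ≠ b) : d ≤ f a + f b := by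
  have hmix : ∀ a ∈ D, ∀ b ∈ T, b ∉ D → d ≤ f a + f b := by
    intro a ha b hb hbD
    by_cases hau : a = u
    · exact (hD a ha v hv (hau ▸ huv)).trans (Nat.add_le_add_left (hdom b hb hbD v hv) _)
    · exact (hD a ha u hu hau).trans (Nat.add_le_add_left (hdom b hb hbD u hu) _)
  by_cases haD : a ∈ D <;> by_cases hbD : b ∈ D
  · exact hD a haD b hbD hab
  · exact hmix a haD b hb hbD
  · rw [add_comm]
    exact hmix b hbD a ha haD
  · exact (hD u hu v hv huv).trans (add_le_add (hdom a ha haD u hu) (hdom b hb hbD v hv))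

theorem le_add_of_classes {k t l d : ℕ} {p : Fin k ⊕ Fin t → PG k} (hp : Function.Injective p)
    {S : Fin t → Set (PG k)} (hrange : ∀ j, ∀ x ∈ S j, ∃ i, p (Sum.inl i) = x)
    {T : Fin t → Finset (Fin k ⊕ Fin t)} (hTl : ∀ j i, Sum.inl i ∈ T j ↔ p (Sum.inl i) ∈ S j)
    (hTr : ∀ j j', Sum.inr j' ∈ T j ↔ j' = j) {cls : Fin t → Fin l}
    (hdisj : ∀ i j, cls i ≠ cls j → S i ∩ S j = ∅) {m : PG k → ℕ}
    (htwin : ∀ a b, a ≠ b → (∀ j, a ∈ T j ↔ b ∈ T j) → d ≤ m (p a) + m (p b))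
    (hcls : ∀ a : Fin l,
      RepresentingIndependent S {j | cls j = a} ∨
        (CondOne S (fun j => p (Sum.inr j)) m {j | cls j = a} ∨
         CondTwo S (fun j => p (Sum.inr j)) m {j | cls j = a} ∨
         CondThree S (fun j => p (Sum.inr j)) m {j | cls j = a}))
    (j : Fin t) {a b : Fin k ⊕ Fin t} (ha : a ∈ T j) (hb : b ∈ T j) (hab : a ≠ b) :
    d ≤ m (p a) + m (p b) := by
  set J : Set (Fin t) := {j' | cls j' = cls j} with hJ
  have hjJ : j ∈ J := rfl
  have hmemJ : ∀ {x : PG k} {j₁ j₂ : Fin t}, x ∈ S j₁ → x ∈ S j₂ → cls j₁ = cls j₂ := by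
    intro x j₁ j₂ h1 h2
    by_contra hne
    have h : x ∈ S j₁ ∩ S j₂ := ⟨h1, h2⟩
    rw [hdisj _ _ hne] at h
    exact h
  -- points that lie in exactly one check
  have hprivate : ∀ j₀ : Fin t, cls j₀ = cls j → ∀ s ∈ T j₀, p s ∈ U₃ S (fun j => p (Sum.inr j)) J →
      ∀ j', s ∈ T j' ↔ j' = j₀ := by
    rintro j₀ hj₀ (i | i) hs hU j'
    · rw [hTl] at hs ⊢
      rcases hU with ⟨j₁, -, huniq⟩ | ⟨j₁, -, h⟩
      · constructor
        · intro h
          rw [huniq j' ⟨(hmemJ h hs).trans hj₀, h⟩, huniq j₀ ⟨hj₀, hs⟩]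
        · rintro rfl
          exact hs
      · exact absurd (hp h) (by simp)
    · rw [hTr] at hs ⊢
      rw [hs]
      exact eq_comm
  have hU₂ : ∀ j₀ : Fin t, cls j₀ = cls j → ∀ s ∈ T j₀,
      p s ∉ U₃ S (fun j => p (Sum.inr j)) J → p s ∈ U₂ S J := by
    rintro j₀ hj₀ (i | i) hs hU
    · exact ⟨Set.mem_iUnion₂.2 ⟨j₀, hj₀, (hTl _ _).1 hs⟩, fun h => hU (Or.inl h)⟩
    · have h : i = j₀ := (hTr _ _).1 hs
      exact absurd (Or.inr ⟨i, h ▸ hj₀, rfl⟩) hU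
  have hself : ∀ j₀ : Fin t, cls j₀ = cls j →
      p (Sum.inr j₀) ∈ U₃ S (fun j => p (Sum.inr j)) J := fun j₀ hj₀ => Or.inr ⟨j₀, hj₀, rfl⟩
  have hW₁ : ∀ j₀ : Fin t, cls j₀ = cls j → (S j₀ ∩ U₁ S J).Nonempty →
      ∃ i, Sum.inl i ∈ T j₀ ∧ p (Sum.inl i) ∈ U₁ S J := by
    rintro j₀ - ⟨x, hx, hxU⟩
    obtain ⟨i, rfl⟩ := hrange j₀ x hx
    exact ⟨i, (hTl _ _).2 hx, hxU⟩
  have hmeets : (S j ∩ U₁ S J).Nonempty →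
      (∀ x ∈ U₂ S J, ∀ y ∈ U₃ S (fun j => p (Sum.inr j)) J, m y ≤ m x) →
      d ≤ m (p a) + m (p b) := by
    intro hne hmin
    obtain ⟨i, hiT, hiU⟩ := hW₁ j hjJ hne
    -- The light symbols are those in this check alone: the further point itself and at least one
    -- point of `U₁`.
    refine le_add_of_light (f := fun s => m (p s)) (T := {s | s ∈ T j})
      (D := {s | s ∈ T j ∧ p s ∈ U₃ S (fun j => p (Sum.inr j)) J})
      (fun u hu v hv huv => htwin u v huv fun j' => ?_) (u := Sum.inl i) (v := Sum.inr j)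
      ⟨hiT, Or.inl hiU⟩ ⟨(hTr _ _).2 rfl, hself j hjJ⟩ (by simp)
      (fun u hu huD v hv => hmin _ (hU₂ j hjJ u hu fun h => huD ⟨hu, h⟩) _ hv.2) ha hb hab
    rw [hprivate j hjJ u hu.1 hu.2, hprivate j hjJ v hv.1 hv.2]
  rcases hcls (cls j) with hind | hone | htwo | hthree
  · have hmem : ∀ s ∈ T j, ∀ j', s ∈ T j' ↔ j' = j := by
      rintro (i | i) hs j'
      · rw [hTl] at hs ⊢
        constructor
        · intro h
          by_contra hne
          have h' : p (Sum.inl i) ∈ S j' ∩ S j := ⟨h, hs⟩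
          rw [hind j' (hmemJ h hs) j rfl hne] at h'
          exact h'
        · rintro rfl
          exact hs
      · rw [hTr] at hs ⊢
        rw [hs]
        exact eq_comm
    exact htwin a b hab fun j' => by rw [hmem a ha, hmem b hb]
  · exact hmeets (hone.1 j rfl) hone.2
  · obtain ⟨-, -, hmin, i₁, ⟨hi₁, hi₁U⟩, hle⟩ := htwo
    by_cases hne : (S j ∩ U₁ S J).Nonempty
    · exact hmeets hne hmin
    have hempty : S j ∩ U₁ S J = ∅ := Set.not_nonempty_iff_eq_empty.1 hne
    obtain ⟨i, hiT, hiU⟩ := hW₁ i₁ hi₁ hi₁U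
    -- This check has no point of `U₁`, so its pairs are compared with twins of another check, the
    -- one of the lightest point from `W₁`.
    have hd : d ≤ m (p (Sum.inr i₁)) + m (p (Sum.inl i)) := htwin _ _ (by simp) fun j' => by
      rw [hprivate i₁ hi₁ _ hiT (Or.inl hiU),
        hprivate i₁ hi₁ _ ((hTr _ _).2 rfl) (hself i₁ hi₁)]
    have hheavy : ∀ i', Sum.inl i' ∈ T j → p (Sum.inl i') ∈ U₂ S J := by
      intro i' hi'
      refine ⟨Set.mem_iUnion₂.2 ⟨j, hjJ, (hTl _ _).1 hi'⟩, fun h => ?_⟩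
      exact hne ⟨_, (hTl _ _).1 hi', h⟩
    have hq : ∀ s ∈ T j, m (p (Sum.inr i₁)) ≤ m (p s) := by
      rintro (s | s) hs
      · exact hmin _ (hheavy s hs) _ (hself i₁ hi₁)
      · rw [(hTr _ _).1 hs]
        exact hle j ⟨hjJ, hempty⟩
    have hu : ∀ i', Sum.inl i' ∈ T j → m (p (Sum.inl i)) ≤ m (p (Sum.inl i')) :=
      fun i' hi' => hmin _ (hheavy i' hi') _ (Or.inl hiU)
    rcases a with a | a
    · have h1 := hu a ha
      have h2 := hq b hb
      omega
    · rcases b with b | b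
      · have h1 := hu b hb
        have h2 := hq _ ha
        omega
      · exact absurd (congrArg Sum.inr (((hTr _ _).1 ha).trans ((hTr _ _).1 hb).symm)) hab
  · obtain ⟨hcard, hmax⟩ := hthree
    have hcommon : ∀ x ∈ commonSet S J, x ∈ S j := fun x hx => Set.mem_iInter₂.1 hx j hjJ
    -- Points common to all representing-sets of the class lie in exactly the checks of the class,
    -- so any two of them are twins.
    obtain ⟨x, hx, y, hy, hxy⟩ := (Set.one_lt_ncard_iff_nontrivial_and_finite.1 hcard).1
    obtain ⟨u, rfl⟩ := hrange j x (hcommon x hx)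
    obtain ⟨v, rfl⟩ := hrange j y (hcommon y hy)
    have hmem : ∀ s ∈ T j, p s ∈ commonSet S J → ∀ j', s ∈ T j' ↔ cls j' = cls j := by
      rintro s hs hI j'
      obtain ⟨i, hi⟩ := hrange j _ (hcommon _ hI)
      obtain rfl := hp hi
      rw [hTl]
      exact ⟨fun h => hmemJ h (hcommon _ hI), fun h => Set.mem_iInter₂.1 hI j' h⟩
    refine le_add_of_light (f := fun s => m (p s)) (T := {s | s ∈ T j})
      (D := {s | s ∈ T j ∧ p s ∈ commonSet S J})
      (fun u hu v hv huv => htwin u v huv fun j' => by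
        rw [hmem u hu.1 hu.2, hmem v hv.1 hv.2]) (u := Sum.inl u) (v := Sum.inl v)
      ⟨(hTl _ _).2 (hcommon _ hx), hx⟩ ⟨(hTl _ _).2 (hcommon _ hy), hy⟩
      (fun h => hxy (congrArg p h)) (fun s hs hsD s' hs' => hmax _ hs'.2 _ ?_) ha hb hab
    rcases s with s | s
    · exact Or.inl ⟨Set.mem_iUnion₂.2 ⟨j, hjJ, (hTl _ _).1 hs⟩, fun h => hsD ⟨hs, h⟩⟩
    · have h : s = j := (hTr _ _).1 hs
      exact Or.inr ⟨s, congrArg cls h, rfl⟩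

/-! ### Points of the projective space -/

theorem rep_mk {k : ℕ} {v : Fin k → ZMod 2} (hv : v ≠ 0) :
    (Projectivization.mk (ZMod 2) v hv).rep = v := by
  have h := Projectivization.mk_rep (Projectivization.mk (ZMod 2) v hv)
  rw [Projectivization.mk_eq_mk_iff'] at h
  obtain ⟨a, ha⟩ := h
  have h01 : ∀ a : ZMod 2, a = 0 ∨ a = 1 := by decide
  rcases h01 a with rfl | rfl
  · rw [zero_smul] at ha
    exact absurd ha.symm (Projectivization.rep_nonzero _)
  · rw [← ha, one_smul]

theorem mem_reprSet_iff {k : ℕ} {b : Fin k → PG k} (hb : Function.Injective b)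
    (B : Module.Basis (Fin k) (ZMod 2) (Fin k → ZMod 2)) (hB : ∀ i, B i = (b i).rep) (x : PG k)
    (i : Fin k) : b i ∈ reprSet b x ↔ B.repr x.rep i ≠ 0 := by
  constructor
  · rintro ⟨c, hc, i', hi', h⟩
    obtain rfl := hb h
    simp only [← hB] at hc
    rwa [hc, B.repr_sum_self]
  · intro h
    refine ⟨B.repr x.rep, ?_, i, h, rfl⟩
    simp only [← hB]
    exact (B.sum_repr _).symm

theorem Determines.exists_column_map {k n : ℕ} {ι : Type*} {m : PG k → ℕ}
    {G : Matrix (Fin k) (Fin n) (ZMod 2)} (hG : Determines m G) {p : ι → PG k}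
    (hm : ∀ x, x ∉ Set.range p → m x = 0) :
    ∃ col : Fin n → ι, (∀ i, Gᵀ i = (p (col i)).rep) ∧
      ∀ x, {i | p (col i) = x}.ncard = m x := by
  obtain ⟨h, hcard⟩ := hG
  have hex : ∀ i, ∃ s, p s = Projectivization.mk (ZMod 2) (Gᵀ i) (h i) := by
    intro i
    by_contra hne
    have h0 := hcard (Projectivization.mk (ZMod 2) (Gᵀ i) (h i))
    rw [hm _ hne, Set.ncard_eq_zero] at h0
    exact Set.eq_empty_iff_forall_notMem.1 h0 i rfl
  choose col hcol using hex
  refine ⟨col, fun i => by rw [hcol, rep_mk], fun x => ?_⟩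
  simp only [hcol]
  exact hcard x

/-- The support of the check that expresses a further point through the basis points. -/
noncomputable def checkSupport {k t : ℕ} (B : Module.Basis (Fin k) (ZMod 2) (Fin k → ZMod 2))
    (w : Fin t → Fin k → ZMod 2) (j : Fin t) : Finset (Fin k ⊕ Fin t) :=
  (Finset.univ.filter fun i => B.repr (w j) i ≠ 0).disjSum {j}

theorem sum_checkSupport {k t : ℕ} {M : Type*} [AddCommGroup M] [Module (ZMod 2) M]
    (B : Module.Basis (Fin k) (ZMod 2) (Fin k → ZMod 2)) (w : Fin t → Fin k → ZMod 2)
    (j : Fin t) (f : Fin k ⊕ Fin t → M) :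
    ∑ s ∈ checkSupport B w j, f s =
      ∑ i, B.repr (w j) i • f (Sum.inl i) + f (Sum.inr j) := by
  have hone : ∀ a : ZMod 2, a ≠ 0 → a = 1 := by decide
  rw [checkSupport, Finset.sum_disjSum, Finset.sum_filter, Finset.sum_singleton]
  congr 1
  refine Finset.sum_congr rfl fun i _ => ?_
  by_cases h : B.repr (w j) i = 0
  · simp [h]
  · simp [hone _ h]

/-- Codewords are the values of linear functionals at the columns. A functional is free on the
basis, and the checks say that its values at the further points are the ones forced by linearity. -/
theorem isRepeatedCode_codeOf {k t n : ℕ} {G : Matrix (Fin k) (Fin n) (ZMod 2)}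
    {B : Module.Basis (Fin k) (ZMod 2) (Fin k → ZMod 2)} {w : Fin t → Fin k → ZMod 2}
    {col : Fin n → Fin k ⊕ Fin t} (hG : ∀ i, Gᵀ i = Sum.elim B w (col i)) :
    IsRepeatedCode col (checkSupport B w) (codeOf G) := by
  have htwo : ∀ a : ZMod 2, a + a = 0 := by decide
  have hsub : ∀ a b : ZMod 2, a + b = 0 → b = a := by decide
  intro c
  rw [mem_codeOf]
  constructor
  · rintro ⟨u, hu⟩
    refine ⟨fun s => u ⬝ᵥ Sum.elim B w s, fun j => ?_, fun i => by rw [hu, hG]⟩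
    rw [sum_checkSupport]
    simp only [Sum.elim_inl, Sum.elim_inr]
    have h : u ⬝ᵥ w j = ∑ i, B.repr (w j) i • (u ⬝ᵥ B i) := by
      conv_lhs => rw [← B.sum_repr (w j)]
      simp only [dotProduct_sum, dotProduct_smul]
    rw [h]
    exact htwo _
  · rintro ⟨y, hy, hc⟩
    let φ := B.constr (ZMod 2) fun i => y (Sum.inl i)
    have hφ : ∀ s, φ (Sum.elim B w s) = y s := by
      rintro (i | j)
      · exact B.constr_basis _ _ i
      · have h := hy j
        rw [sum_checkSupport] at h
        rw [Sum.elim_inr, hsub _ _ h]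
        exact B.constr_apply_fintype _ _ _
    refine ⟨fun a => φ (Pi.single a 1), fun i => ?_⟩
    rw [hc, hG, ← hφ, LinearMap.pi_apply_eq_sum_univ φ (Sum.elim B w (col i))]
    refine Finset.sum_congr rfl fun a _ => ?_
    rw [smul_eq_mul, mul_comm]
    congr 2
    ext b
    simp [Pi.single_apply, eq_comm]

end PseudoRedundancy


/-! ### The main theorem -/

theorem mainTheorem8 (k t l n : ℕ) (hk : 1 ≤ k)
    -- basis points `p (inl i)` and further points `p (inr j)`, all distinct
    (p : Fin k ⊕ Fin t → PG k) (hp : Function.Injective p)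
    (hb : Projectivization.Independent (fun i : Fin k => p (Sum.inl i)))
    -- representing-sets of the further points
    (S : Fin t → Set (PG k))
    (hS : ∀ j, S j = reprSet (fun i : Fin k => p (Sum.inl i)) (p (Sum.inr j)))
    -- division of the further points into `l` classes
    (cls : Fin t → Fin l)
    (hdisj : ∀ i j, cls i ≠ cls j → S i ∩ S j = ∅)
    (m : PG k → ℕ)
    (hm_pos : ∀ i, 1 ≤ m (p i)) (hm_zero : ∀ x, x ∉ Set.range p → m x = 0)
    (hcls : ∀ a : Fin l,
      RepresentingIndependent S {j | cls j = a} ∨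
      (RepresentingDependent S {j | cls j = a} ∧
        (CondOne S (fun j => p (Sum.inr j)) m {j | cls j = a} ∨
         CondTwo S (fun j => p (Sum.inr j)) m {j | cls j = a} ∨
         CondThree S (fun j => p (Sum.inr j)) m {j | cls j = a})))
    (G : Matrix (Fin k) (Fin n) (ZMod 2)) (hG : Determines m G) :
    Module.finrank (ZMod 2) (codeOf G) = k ∧ k ≤ n ∧
      ∀ ch : Channel, pseudoredundancy ch (codeOf G) = ((n - k : ℕ) : ℕ∞) := by
  obtain ⟨col, hcolG, hcard⟩ := hG.exists_column_map hm_zero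
  have hmult : ∀ s, symbolMult col s = m (p s) := by
    intro s
    rw [← hcard, symbolMult, ← Set.ncard_coe_finset]
    congr 1
    ext i
    simp [hp.eq_iff]
  -- Positive multiplicities make every point occur as a column.
  have hsurj : Function.Surjective col := by
    intro s
    have h : 0 < symbolMult col s := by
      rw [hmult]
      exact hm_pos s
    obtain ⟨i, hi⟩ := Finset.card_pos.1 h
    exact ⟨i, (Finset.mem_filter.1 hi).2⟩
  have hlin : LinearIndependent (ZMod 2) fun i : Fin k => (p (Sum.inl i)).rep :=
    Projectivization.independent_iff.1 hb
  have : Nonempty (Fin k) := ⟨⟨0, hk⟩⟩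
  obtain ⟨B, hB⟩ : ∃ B : Module.Basis (Fin k) (ZMod 2) (Fin k → ZMod 2),
      ∀ i, B i = (p (Sum.inl i)).rep :=
    ⟨basisOfLinearIndependentOfCardEqFinrank hlin (by simp), fun i => by simp⟩
  have hGB : ∀ i, G.transpose i = Sum.elim B (fun j => (p (Sum.inr j)).rep) (col i) := by
    intro i
    rw [hcolG]
    rcases col i with a | a <;> simp [hB]
  have hrank : Module.finrank (ZMod 2) (codeOf G) = k := by
    refine finrank_codeOf ?_
    rw [← B.span_eq, Submodule.span_le]
    rintro _ ⟨i, rfl⟩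
    obtain ⟨a, ha⟩ := hsurj (Sum.inl i)
    refine Submodule.subset_span ⟨a, ?_⟩
    rw [hGB, ha, Sum.elim_inl]
  have hcode := isRepeatedCode_codeOf hGB
  refine ⟨hrank, ?_, pseudoredundancy_of_isRepeatedCode hsurj hcode hk hrank ?_⟩
  · have h := Submodule.finrank_le (codeOf G)
    rwa [hrank, Module.finrank_fin_fun] at h
  · intro j a ha b hb' hab
    simp only [hmult]
    refine le_add_of_classes hp (S := S) (cls := cls) (fun j x hx => ?_) (fun j i => ?_)
      (fun j j' => ?_) hdisj (fun a b hab h => ?_) (fun a => (hcls a).imp_right And.right)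
      j ha hb' hab
    · rw [hS] at hx
      obtain ⟨c, -, i, -, hi⟩ := hx
      exact ⟨i, hi⟩
    · rw [hS, mem_reprSet_iff (b := fun i => p (Sum.inl i)) (hp.comp Sum.inl_injective) B hB]
      simp [checkSupport]
    · simp [checkSupport]
    · rw [← hmult, ← hmult]
      exact minDist_le_of_twins hsurj hcode hab h
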